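/- All systems are finite-dimensional, nonzero complex Hilbert spaces; $|A|$ is the dimension of $A$, $AB$ stands for $A\otimes B$, and $\mathrm{CPTP}(A\to B)$ is the set of quantum channels from $A$ to $B$. An isometry channel is a channel of the form $\rho\mapsto V\rho V^\dagger$ with $V^\dagger V=\mathbf 1$, and $\mathbf u^{B}=\mathbf 1_B/|B|$ is the uniform state. States are regarded as channels with one-dimensional input. Every superchannel $\Theta$ taking channels $A\to B$ to channels $A'\to B$ has the form $\Theta[\mathcal N]=\mathcal E^{RB\to B}\circ(\mathsf{id}^R\otimes\mathcal N^{A\to B})\circ\mathcal U^{A'\to RA}$ with an isometry channel $\mathcal U$ and a channel $\mathcal E$; it is in standard form if $|R|$ is the least possible. $\Theta$ is mixing if in its standard form $\mathcal E$ is conditionally unital, i.e. $\omega\mapsto\mathcal E(\tau^R\otimes\omega)$ is a unital channel for every density matrix $\tau$ on $R$. For $\mathcal N\in\mathrm{CPTP}(A\to B)$ and $\mathcal M\in\mathrm{CPTP}(A'\to B)$ write $\mathcal N\succ\mathcal M$ if $\mathcal M=\Theta[\mathcal N]$ for some mixing superchannel $\Theta$, and $\mathcal N\sim\mathcal M$ if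 $\mathcal N\succ\mathcal M$ and $\mathcal M\succ\mathcal N$. **Theorem.** Let $\mathcal V\in\mathrm{CPTP}(A\to B)$ be an isometry channel. 1. If $|B'|=|A|$, then $\mathcal V^{A\to B}\otimes\mathbf u^{B'}\sim\psi^{BB'}$ for every pure state $\psi$ of $BB'$. 2. More generally, let $B',C,D,D'$ be systems with $|BB'|=|DD'|$ and $|AB|\ge|CD|$, and let $\mathcal M\in\mathrm{CPTP}(C\to D)$ be any channel. Then $\mathcal V^{A\to B}\otimes\mathbf u^{B'}\succ\mathcal M^{C\to D}\otimes\mathbf u^{D'}$, where $BB'$ and $DD'$ are identified by an arbitrary unitary. 3. In particular, isometry channels are maximal: $\mathcal V\succ\mathcal M$ for every $\mathcal M\in\mathrm{CPTP}(A\to B)$. -/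

import Mathlib

open scoped Kronecker ComplexOrder

namespace ChannelMajorization

/-- A finite-dimensional system with orthonormal basis labelled by `A` has the operator space
`Matrix A A ℂ`. Linear maps from the operators on `A` to the operators on `B`. -/
abbrev MatMap (A B : Type*) := Matrix A A ℂ →ₗ[ℂ] Matrix B B ℂ

/-- The map `id_R ⊗ Φ`: apply `Φ` to every `A`-block of an operator on `R ⊗ A`. -/
def ampliate (R : Type*) {A B : Type*} (Φ : MatMap A B) : MatMap (R × A) (R × B) where
  toFun X := Matrix.of fun p q =>
    Φ (Matrix.of fun a a' => X (p.1, a) (q.1, a')) p.2 q.2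
  map_add' X Y := by
    ext p q
    have h : (Matrix.of fun a a' => (X + Y) (p.1, a) (q.1, a')) =
        (Matrix.of fun a a' => X (p.1, a) (q.1, a')) +
          (Matrix.of fun a a' => Y (p.1, a) (q.1, a')) := rfl
    rw [Matrix.of_apply, h, map_add]
    rfl
  map_smul' c X := by
    ext p q
    have h : (Matrix.of fun a a' => (c • X) (p.1, a) (q.1, a')) =
        c • (Matrix.of fun a a' => X (p.1, a) (q.1, a')) := rfl
    rw [Matrix.of_apply, h, map_smul]
    rfl

/-- Complete positivity. -/
def IsCompletelyPositive {A B : Type*} (Φ : MatMap A B) : Prop :=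
  ∀ (k : ℕ) (X : Matrix (Fin k × A) (Fin k × A) ℂ),
    X.PosSemidef → (ampliate (Fin k) Φ X).PosSemidef

/-- Quantum channels: completely positive, trace-preserving maps. -/
def IsChannel {A B : Type*} [Fintype A] [Fintype B] (Φ : MatMap A B) : Prop :=
  IsCompletelyPositive Φ ∧ ∀ X : Matrix A A ℂ, (Φ X).trace = X.trace

/-- The map `X ↦ V X V†`. -/
def conjMap {A B : Type*} [Fintype A] (V : Matrix B A ℂ) : MatMap A B where
  toFun X := V * X * V.conjTranspose
  map_add' X Y := by rw [Matrix.mul_add, Matrix.add_mul]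
  map_smul' c X := by simp

/-- `V` is the matrix of an isometry, `V† V = 1`. -/
def IsIsometry {A B : Type*} [Fintype B] [DecidableEq A] (V : Matrix B A ℂ) : Prop :=
  V.conjTranspose * V = 1

/-- Isometry channels, `ρ ↦ V ρ V†` with `V† V = 1`. -/
def IsIsometryChannel {A B : Type*} [Fintype A] [Fintype B] [DecidableEq A]
    (Φ : MatMap A B) : Prop :=
  ∃ V : Matrix B A ℂ, IsIsometry V ∧ Φ = conjMap V

/-- Density matrices. -/
def IsState {B : Type*} [Fintype B] (ρ : Matrix B B ℂ) : Prop :=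
  ρ.PosSemidef ∧ ρ.trace = 1

/-- Pure states, `|v⟩⟨v|` for a unit vector `v`. -/
def IsPureState {B : Type*} [Fintype B] (ψ : Matrix B B ℂ) : Prop :=
  ∃ v : B → ℂ, star v ⬝ᵥ v = 1 ∧ ψ = Matrix.vecMulVec v (star v)

/-- The uniform (maximally mixed) state `1 / |B|`. -/
noncomputable def uniformState (B : Type*) [Fintype B] [DecidableEq B] : Matrix B B ℂ :=
  (Fintype.card B : ℂ)⁻¹ • (1 : Matrix B B ℂ)

/-- A state seen as a channel with trivial (one-dimensional) input system. -/
def stateChannel {B : Type*} (ρ : Matrix B B ℂ) : MatMap Unit B where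
  toFun X := X () () • ρ
  map_add' X Y := by rw [Matrix.add_apply, add_smul]
  map_smul' c X := by rw [Matrix.smul_apply, smul_assoc, RingHom.id_apply]

/-- The channel `Φ ⊗ u^{B'}` from `A` to `B ⊗ B'`, where the uniform state `u^{B'}` is a channel
with trivial input: `X ↦ Φ X ⊗ u^{B'}`. -/
noncomputable def tensorUniform (B' : Type*) [Fintype B'] [DecidableEq B'] {A B : Type*}
    (Φ : MatMap A B) : MatMap A (B × B') where
  toFun X := Φ X ⊗ₖ uniformState B'
  map_add' X Y := by rw [map_add, Matrix.add_kronecker]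
  map_smul' c X := by rw [map_smul, Matrix.smul_kronecker, RingHom.id_apply]

/-- The map `E_τ : X ↦ E (τ ⊗ X)`. -/
def withSide {R B B₁ : Type*} (E : MatMap (R × B) B₁) (τ : Matrix R R ℂ) : MatMap B B₁ where
  toFun X := E (τ ⊗ₖ X)
  map_add' X Y := by rw [Matrix.kronecker_add, map_add]
  map_smul' c X := by rw [Matrix.kronecker_smul, map_smul, RingHom.id_apply]

/-- Doubly stochastic channels: unital channels. -/
def IsDoublyStochastic {B : Type*} [Fintype B] [DecidableEq B] (Φ : MatMap B B) : Prop :=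
  IsChannel Φ ∧ Φ 1 = 1

/-- Conditionally unital channels `E : RB → B`: for every state `τ` of `R`, the map
`X ↦ E (τ ⊗ X)` is a doubly stochastic channel. -/
def IsConditionallyUnital {R B : Type*} [Fintype R] [Fintype B] [DecidableEq B]
    (E : MatMap (R × B) B) : Prop :=
  IsChannel E ∧ ∀ τ : Matrix R R ℂ, IsState τ → IsDoublyStochastic (withSide E τ)

/-- The supermap `N ↦ E ∘ (id_R ⊗ N) ∘ V` with preprocessing `V : A' → RA` and
postprocessing `E : RB → B`. As usual for superchannels, it acts on all linear maps. -/
def superMap {R A A' B : Type*} [Fintype A'] (E : MatMap (R × B) B)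
    (V : Matrix (R × A) A' ℂ) : MatMap A B → MatMap A' B :=
  fun N => E ∘ₗ ampliate R N ∘ₗ conjMap V

/-- `Θ` is realized with an auxiliary system of dimension `r`, the channel `E : RB → B` and the
isometry `V : A' → RA`. -/
def IsRealization {A A' B : Type*} [Fintype A] [Fintype A'] [Fintype B] [DecidableEq A']
    (Θ : MatMap A B → MatMap A' B) (r : ℕ) (E : MatMap (Fin r × B) B)
    (V : Matrix (Fin r × A) A' ℂ) : Prop :=
  IsChannel E ∧ IsIsometry V ∧ Θ = superMap E V

/-- A standard form of a superchannel is a realization in which the dimension of the auxiliary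
system is the smallest possible one. -/
def IsStandardForm {A A' B : Type*} [Fintype A] [Fintype A'] [Fintype B] [DecidableEq A']
    (Θ : MatMap A B → MatMap A' B) (r : ℕ) (E : MatMap (Fin r × B) B)
    (V : Matrix (Fin r × A) A' ℂ) : Prop :=
  IsRealization Θ r E V ∧
    ∀ (r' : ℕ) (E' : MatMap (Fin r' × B) B) (V' : Matrix (Fin r' × A) A' ℂ),
      IsRealization Θ r' E' V' → r ≤ r'

/-- Mixing superchannels: superchannels that have a standard form with conditionally unital
postprocessing. -/
def IsMixing {A A' B : Type*} [Fintype A] [Fintype A'] [Fintype B] [DecidableEq A']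
    [DecidableEq B] (Θ : MatMap A B → MatMap A' B) : Prop :=
  ∃ (r : ℕ) (E : MatMap (Fin r × B) B) (V : Matrix (Fin r × A) A' ℂ),
    IsStandardForm Θ r E V ∧ IsConditionallyUnital E

/-- Channel majorization `N ≻ M` for channels with the same output system. -/
def Majorizes {A A' B : Type*} [Fintype A] [Fintype A'] [Fintype B] [DecidableEq A']
    [DecidableEq B] (N : MatMap A B) (M : MatMap A' B) : Prop :=
  ∃ Θ : MatMap A B → MatMap A' B, IsMixing Θ ∧ M = Θ N

/-- Equivalence under channel majorization, `N ∼ M`. -/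
def Equivalent {A A' B : Type*} [Fintype A] [Fintype A'] [Fintype B] [DecidableEq A]
    [DecidableEq A'] [DecidableEq B] (N : MatMap A B) (M : MatMap A' B) : Prop :=
  Majorizes N M ∧ Majorizes M N

end ChannelMajorization

open ChannelMajorization

namespace ChannelMajorization

/-! One protocol proves all three claims (`majorizes_of_choi_mul_self`). Suppose the Choi matrix of
a channel N : A → O is sP with P a projection. To simulate T : C → O, append a maximally entangled
state of AA to the input, send one half through N, and measure {P, 1 - P} on AO. The normalized Choi
state of N lies in the range of P, so the outcome P is certain, and T is then applied to the
untouched C.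

The other outcome never occurs on N, so its branch is free to be chosen to make the postprocessing
conditionally unital. Trace preservation of N gives tr_O P = s⁻¹ 1. For a state τ of CA with
marginal τ_C, the P branch therefore sends τ ⊗ 1 to s⁻¹ T(τ_C), and the missing part of the identity
is S(τ_C) with S(Z) = (tr Z) 1 - s⁻¹ T(Z). The second branch applies S divided by its trace factor,
which is legitimate exactly when S is completely positive.

The auxiliary system CA is minimal because the isometry has a full-rank reduced operator on it
(`IsRealization.isStandardForm`). An isometry V has s = |A|, V ⊗ u^{B'} has s = |A|/|B'|, and a pure
state has s = 1. Complete positivity of S follows from a dimension count, since a Choi matrix is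
bounded by its trace. -/

/-- The (unnormalized) Choi matrix of a linear map. -/
def choi {A B : Type*} [DecidableEq A] (Φ : MatMap A B) : Matrix (A × B) (A × B) ℂ :=
  Matrix.of fun p q => Φ (Matrix.single p.1 q.1 1) p.2 q.2

/-! ### Complete positivity through Choi matrices -/

section Choi

variable {A B : Type*} [Fintype A] [DecidableEq A]

theorem map_apply_eq_sum_choi (Φ : MatMap A B) (X : Matrix A A ℂ) (b b' : B) :
    Φ X b b' = ∑ a, ∑ a', X a a' * choi Φ (a, b) (a', b') := by
  conv_lhs => rw [Matrix.matrix_eq_sum_single X]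
  simp only [map_sum, Matrix.sum_apply]
  refine Finset.sum_congr rfl fun a _ => Finset.sum_congr rfl fun a' _ => ?_
  have h : Matrix.single a a' (X a a') = X a a' • Matrix.single a a' (1 : ℂ) := by simp
  rw [h, map_smul]
  rfl

theorem IsCompletelyPositive.posSemidef_choi {Φ : MatMap A B} (h : IsCompletelyPositive Φ) :
    (choi Φ).PosSemidef := by
  let e := Fintype.equivFin A
  -- The unnormalized maximally entangled vector, whose image under the ampliation is the Choi
  -- matrix.
  let v : Fin (Fintype.card A) × A → ℂ := fun p => if p.1 = e p.2 then 1 else 0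
  have h1 := h _ _ (Matrix.posSemidef_vecMulVec_self_star v)
  have h2 := h1.submatrix (fun p : A × B => (e p.1, p.2))
  convert h2 using 1
  ext p q
  simp only [choi, Matrix.of_apply, Matrix.submatrix_apply, ampliate, LinearMap.coe_mk,
    AddHom.coe_mk]
  refine congrArg (fun Z => Φ Z p.2 q.2) ?_
  ext a a'
  by_cases h1 : p.1 = a <;> by_cases h2 : q.1 = a' <;>
    simp [Matrix.vecMulVec_apply, v, h1, h2]

/-- The ampliation is a compression of X ⊗ `choi Φ`: the matrix Q contracts the two copies of A with
the maximally entangled vector. -/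
theorem isCompletelyPositive_of_posSemidef_choi [Fintype B] {Φ : MatMap A B}
    (h : (choi Φ).PosSemidef) : IsCompletelyPositive Φ := by
  classical
  intro k X hX
  let Q : Matrix (Fin k × B) ((Fin k × A) × (A × B)) ℂ :=
    Matrix.of fun p q => if p.1 = q.1.1 ∧ p.2 = q.2.2 ∧ q.1.2 = q.2.1 then 1 else 0
  have h2 := (hX.kronecker h).mul_mul_conjTranspose_same Q
  refine (congrArg Matrix.PosSemidef (Matrix.ext fun p q => ?_)).mpr h2
  simp only [ampliate, LinearMap.coe_mk, AddHom.coe_mk, Matrix.of_apply]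
  rw [map_apply_eq_sum_choi]
  simp only [Matrix.mul_apply, Matrix.conjTranspose_apply, Matrix.kroneckerMap_apply, Q,
    Matrix.of_apply, Fintype.sum_prod_type, ite_and, apply_ite star, star_one,
    star_zero, mul_ite, mul_one, mul_zero, ite_mul, one_mul, zero_mul, Finset.sum_ite_eq,
    Finset.mem_univ, if_true, Finset.sum_ite_irrel, Finset.sum_const_zero]
  rw [Finset.sum_comm]

theorem eq_zero_of_choi_eq_zero {Φ : MatMap A B} (h : choi Φ = 0) : Φ = 0 := by
  ext X b b'
  simp [map_apply_eq_sum_choi Φ, h]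

theorem trace_choi [Fintype B] (Φ : MatMap A B) : (choi Φ).trace = (Φ 1).trace := by
  simp only [Matrix.trace, Matrix.diag, map_apply_eq_sum_choi Φ 1, Fintype.sum_prod_type]
  rw [Finset.sum_comm]
  simp [Matrix.one_apply]

theorem choi_conjMap (V : Matrix B A ℂ) :
    choi (conjMap V) =
      Matrix.vecMulVec (fun p => V p.2 p.1) (star fun p : A × B => V p.2 p.1) := by
  ext p q
  simp only [choi, conjMap, Matrix.of_apply, LinearMap.coe_mk, AddHom.coe_mk, Matrix.vecMulVec_apply,
    Matrix.mul_apply, Matrix.conjTranspose_apply, Matrix.single_apply, Pi.star_apply]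
  simp [ite_and]

theorem isCompletelyPositive_conjMap [Fintype B] (V : Matrix B A ℂ) :
    IsCompletelyPositive (conjMap V) :=
  isCompletelyPositive_of_posSemidef_choi <| by
    rw [choi_conjMap]
    exact Matrix.posSemidef_vecMulVec_self_star _

end Choi

/-! ### Closure properties of channels, and domination by the replacer map -/

section CompletelyPositive

variable {A B C : Type*}

theorem IsCompletelyPositive.comp {Ψ : MatMap B C} {Φ : MatMap A B}
    (hΨ : IsCompletelyPositive Ψ) (hΦ : IsCompletelyPositive Φ) :
    IsCompletelyPositive (Ψ ∘ₗ Φ) :=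
  fun k X hX => hΨ k _ (hΦ k X hX)

theorem IsCompletelyPositive.add {Φ Ψ : MatMap A B} (hΦ : IsCompletelyPositive Φ)
    (hΨ : IsCompletelyPositive Ψ) : IsCompletelyPositive (Φ + Ψ) :=
  fun k X hX => (hΦ k X hX).add (hΨ k X hX)

theorem IsCompletelyPositive.smul {Φ : MatMap A B} (hΦ : IsCompletelyPositive Φ) {c : ℂ}
    (hc : 0 ≤ c) : IsCompletelyPositive (c • Φ) :=
  fun k X hX => (hΦ k X hX).smul hc

/-- The map `X ↦ X ⊗ σ`. -/
def kroneckerRight {S : Type*} (σ : Matrix S S ℂ) : MatMap A (A × S) where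
  toFun X := X ⊗ₖ σ
  map_add' X Y := by rw [Matrix.add_kronecker]
  map_smul' c X := by rw [Matrix.smul_kronecker, RingHom.id_apply]

theorem isCompletelyPositive_kroneckerRight [Finite A] {S : Type*} [Finite S] {σ : Matrix S S ℂ}
    (hσ : σ.PosSemidef) : IsCompletelyPositive (kroneckerRight (A := A) σ) :=
  fun k _ hX => (hX.kronecker hσ).submatrix
    (fun p : Fin k × A × S => ((p.1, p.2.1), p.2.2))

theorem isCompletelyPositive_withSide [Finite B] {R : Type*} [Finite R]
    {E : MatMap (R × B) C} (hE : IsCompletelyPositive E) {τ : Matrix R R ℂ} (hτ : τ.PosSemidef) :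
    IsCompletelyPositive (withSide E τ) :=
  fun k _ hX => hE k _ ((hτ.kronecker hX).submatrix
    (fun p : Fin k × R × B => (p.2.1, (p.1, p.2.2))))

theorem IsChannel.comp [Fintype A] [Fintype B] [Fintype C] {Ψ : MatMap B C} {Φ : MatMap A B}
    (hΨ : IsChannel Ψ) (hΦ : IsChannel Φ) : IsChannel (Ψ ∘ₗ Φ) :=
  ⟨hΨ.1.comp hΦ.1, fun X => (hΨ.2 _).trans (hΦ.2 X)⟩

theorem IsChannel.withSide [Fintype B] [Fintype C] {R : Type*} [Fintype R]
    {E : MatMap (R × B) C} (hE : IsChannel E) {τ : Matrix R R ℂ} (hτ : IsState τ) :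
    IsChannel (withSide E τ) :=
  ⟨isCompletelyPositive_withSide hE.1 hτ.1, fun X =>
    (hE.2 _).trans (by rw [Matrix.trace_kronecker, hτ.2, one_mul])⟩

theorem isChannel_conjMap [Fintype A] [DecidableEq A] [Fintype B] {V : Matrix B A ℂ}
    (hV : IsIsometry V) : IsChannel (conjMap V) :=
  ⟨isCompletelyPositive_conjMap V, fun X => by
    change (V * X * V.conjTranspose).trace = _
    rw [Matrix.trace_mul_cycle, hV, one_mul]⟩

theorem IsIsometryChannel.isChannel [Fintype A] [DecidableEq A] [Fintype B] {Φ : MatMap A B}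
    (h : IsIsometryChannel Φ) : IsChannel Φ := by
  obtain ⟨V, hV, rfl⟩ := h
  exact isChannel_conjMap hV

theorem posSemidef_uniformState (S : Type*) [Fintype S] [DecidableEq S] :
    (uniformState S).PosSemidef :=
  Matrix.PosSemidef.one.smul (by positivity)

theorem IsChannel.tensorUniform [Fintype A] [Fintype B] {Φ : MatMap A B} (hΦ : IsChannel Φ)
    (S : Type*) [Fintype S] [DecidableEq S] [Nonempty S] : IsChannel (tensorUniform S Φ) :=
  ⟨(isCompletelyPositive_kroneckerRight (posSemidef_uniformState S)).comp hΦ.1, fun X => by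
    change (Φ X ⊗ₖ uniformState S).trace = _
    simp [Matrix.trace_kronecker, uniformState, hΦ.2]⟩

theorem IsPureState.isState [Fintype B] {ψ : Matrix B B ℂ} (h : IsPureState ψ) : IsState ψ := by
  obtain ⟨v, hv, rfl⟩ := h
  refine ⟨Matrix.posSemidef_vecMulVec_self_star v, ?_⟩
  rw [Matrix.trace_vecMulVec, dotProduct_comm, hv]

theorem choi_stateChannel (ρ : Matrix B B ℂ) :
    choi (stateChannel ρ) = ρ.submatrix Prod.snd Prod.snd := by
  ext p q
  simp [choi, stateChannel]

theorem IsState.isChannel_stateChannel [Fintype B] {ρ : Matrix B B ℂ} (h : IsState ρ) :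
    IsChannel (stateChannel ρ) := by
  refine ⟨isCompletelyPositive_of_posSemidef_choi ?_, fun X => ?_⟩
  · rw [choi_stateChannel]
    exact h.1.submatrix _
  · change (X () () • ρ).trace = _
    rw [Matrix.trace_smul, h.2]
    simp [Matrix.trace]

/-- The map `Z ↦ (tr Z) 1 - t Φ(Z)`. -/
def traceSubSMul [Fintype A] [DecidableEq B] (t : ℂ) (Φ : MatMap A B) : MatMap A B :=
  (Matrix.traceLinearMap A ℂ ℂ).smulRight 1 - t • Φ

theorem traceSubSMul_apply [Fintype A] [DecidableEq B] (t : ℂ) (Φ : MatMap A B)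
    (X : Matrix A A ℂ) : traceSubSMul t Φ X = X.trace • 1 - t • Φ X := rfl

/-- Each eigenvalue is at most the sum of all of them, as they are nonnegative; diagonalize. -/
theorem _root_.Matrix.PosSemidef.trace_smul_one_sub {n : Type*} [Fintype n] [DecidableEq n]
    {M : Matrix n n ℂ} (hM : M.PosSemidef) : (M.trace • 1 - M).PosSemidef := by
  have hd : (Matrix.diagonal fun i =>
      (M.trace - (hM.1.eigenvalues i : ℂ))).PosSemidef := by
    refine Matrix.PosSemidef.diagonal fun i => ?_
    rw [hM.1.trace_eq_sum_eigenvalues]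
    change (0 : ℂ) ≤ _
    rw [sub_nonneg]
    have h := Finset.single_le_sum (f := hM.1.eigenvalues)
      (fun j _ => hM.eigenvalues_nonneg j) (Finset.mem_univ i)
    have h' := Complex.real_le_real.2 h
    push_cast at h'
    exact h'
  have h := hd.mul_mul_conjTranspose_same (hM.1.eigenvectorUnitary : Matrix n n ℂ)
  convert h using 1
  have hs := hM.1.spectral_theorem
  have hu : (hM.1.eigenvectorUnitary : Matrix n n ℂ) *
      (hM.1.eigenvectorUnitary : Matrix n n ℂ).conjTranspose = 1 :=
    Unitary.mul_star_self_of_mem hM.1.eigenvectorUnitary.2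
  rw [Unitary.conjStarAlgAut_apply] at hs
  have hdiag : (Matrix.diagonal fun i => (M.trace - (hM.1.eigenvalues i : ℂ))) =
      M.trace • 1 - Matrix.diagonal (RCLike.ofReal ∘ hM.1.eigenvalues) := by
    rw [← Matrix.diagonal_one, ← Matrix.diagonal_smul, Matrix.diagonal_sub]
    congr 1
    ext i
    simp
  rw [hdiag, Matrix.mul_sub, Matrix.sub_mul]
  simp only [Matrix.mul_smul, Matrix.smul_mul, mul_one, hu]
  congr 1

theorem choi_traceSubSMul [Fintype A] [DecidableEq A] [DecidableEq B] (t : ℂ) (Φ : MatMap A B) :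
    choi (traceSubSMul t Φ) = 1 - t • choi Φ := by
  ext p q
  simp only [choi, traceSubSMul_apply, Matrix.of_apply, Matrix.sub_apply, Matrix.smul_apply,
    Matrix.one_apply, smul_eq_mul]
  congr 1
  by_cases h : p.1 = q.1
  · simp [h, Prod.ext_iff]
  · simp [h, Prod.ext_iff]

/-- A channel with input `A` is completely dominated by `|A|` times the replacer map
`Z ↦ (tr Z) 1`. -/
theorem IsChannel.isCompletelyPositive_traceSubSMul [Fintype A] [DecidableEq A] [Fintype B]
    [DecidableEq B] {Φ : MatMap A B} (hΦ : IsChannel Φ) {t : ℝ} (ht : 0 ≤ t)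
    (ht' : t * Fintype.card A ≤ 1) : IsCompletelyPositive (traceSubSMul (t : ℂ) Φ) := by
  refine isCompletelyPositive_of_posSemidef_choi ?_
  -- With J the Choi matrix, of trace |A|, write 1 - tJ = t(|A| 1 - J) + (1 - t|A|) 1.
  have hJ := hΦ.1.posSemidef_choi
  have htr : (choi Φ).trace = Fintype.card A := by rw [trace_choi, hΦ.2, Matrix.trace_one]
  have h1 := hJ.trace_smul_one_sub.smul (show (0 : ℂ) ≤ t by exact_mod_cast ht)
  have h2 : ((1 - (t : ℂ) * Fintype.card A) • (1 : Matrix (A × B) (A × B) ℂ)).PosSemidef :=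
    Matrix.PosSemidef.one.smul (by rw [sub_nonneg]; exact_mod_cast ht')
  convert h1.add h2 using 1
  rw [choi_traceSubSMul, htr]
  module

/-- The uniform factor pulls out, leaving the map for Φ with t/|S| in place of t, tensored with 1.
This gains a factor |S| in the admissible t. -/
theorem IsChannel.isCompletelyPositive_traceSubSMul_tensorUniform [Fintype A] [DecidableEq A]
    [Fintype B] [DecidableEq B] {Φ : MatMap A B} (hΦ : IsChannel Φ) (S : Type*) [Fintype S]
    [DecidableEq S] [Nonempty S] {t : ℝ} (ht : 0 ≤ t)
    (ht' : t * Fintype.card A ≤ Fintype.card S) :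
    IsCompletelyPositive (traceSubSMul (t : ℂ) (ChannelMajorization.tensorUniform S Φ)) := by
  have hS : (0 : ℝ) < Fintype.card S := by exact_mod_cast Fintype.card_pos
  have h := (isCompletelyPositive_kroneckerRight (A := B)
    (Matrix.PosSemidef.one (n := S) (R := ℂ))).comp
    (hΦ.isCompletelyPositive_traceSubSMul (t := t / Fintype.card S) (by positivity)
      (by rw [div_mul_eq_mul_div]; exact (div_le_one hS).2 ht'))
  convert h using 1
  refine LinearMap.ext fun X => ?_
  change X.trace • (1 : Matrix (B × S) (B × S) ℂ) - (t : ℂ) • (Φ X ⊗ₖ uniformState S) =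
    (X.trace • (1 : Matrix B B ℂ) - ((t / Fintype.card S : ℝ) : ℂ) • Φ X) ⊗ₖ 1
  rw [sub_eq_add_neg (X.trace • (1 : Matrix B B ℂ)), Matrix.add_kronecker, ← neg_smul,
    Matrix.smul_kronecker, Matrix.smul_kronecker, Matrix.one_kronecker_one, uniformState,
    Matrix.kronecker_smul, smul_smul, neg_smul, ← sub_eq_add_neg]
  push_cast
  rw [div_eq_mul_inv]

end CompletelyPositive

/-! ### Minimality of the auxiliary system -/

section StandardForm

variable {R A A' B : Type*}

/-- The matrix `R × (A ⊗ A')` obtained by moving the index `A` of `V : A' → R ⊗ A` to the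
input side. -/
def rowMatrix (V : Matrix (R × A) A' ℂ) : Matrix R (A × A') ℂ :=
  Matrix.of fun r p => V (r, p.1) p.2

theorem trace_superMap [Fintype R] [Fintype A'] [Fintype B] {E : MatMap (R × B) B}
    (hE : IsChannel E) (V : Matrix (R × A) A' ℂ) (N : MatMap A B) (X : Matrix A' A' ℂ) :
    (superMap E V N X).trace =
      ∑ r, (N (Matrix.of fun a a' => (V * X * V.conjTranspose) (r, a) (r, a'))).trace := by
  change (E (ampliate R N (conjMap V X))).trace = _
  rw [hE.2, Matrix.trace, Fintype.sum_prod_type]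
  rfl

/-- Taking the trace removes E, and matrix units read off the Gram entries of V. The test map need
not be a channel, since a supermap acts on all linear maps. -/
theorem trace_superMap_single [Fintype R] [Fintype A'] [DecidableEq A'] [Fintype B]
    [DecidableEq B] {E : MatMap (R × B) B} (hE : IsChannel E) (V : Matrix (R × A) A' ℂ) (a a' : A)
    (x x' : A') (b : B) :
    (superMap E V ((Matrix.entryLinearMap ℂ ℂ a' a).smulRight (Matrix.single b b 1))
      (Matrix.single x' x 1)).trace =
        ((rowMatrix V).conjTranspose * rowMatrix V) (a, x) (a', x') := by
  rw [trace_superMap hE, Matrix.mul_apply]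
  refine Finset.sum_congr rfl fun r _ => ?_
  change (((V * Matrix.single x' x (1 : ℂ) * V.conjTranspose) (r, a') (r, a)) •
    Matrix.single b b (1 : ℂ)).trace = _
  rw [Matrix.trace_smul, Matrix.trace_single_eq_same]
  simp only [Matrix.mul_apply, Matrix.conjTranspose_apply, Matrix.single_apply, rowMatrix,
    Matrix.of_apply]
  simp [ite_and, mul_comm]

/-- The Gram matrix of the columns of `rowMatrix V` is determined by the superchannel. -/
theorem rowMatrix_gram_eq_of_superMap_eq {R' : Type*} [Fintype R] [Fintype R'] [Fintype A']
    [Fintype B] [Nonempty B] {E : MatMap (R × B) B} {E' : MatMap (R' × B) B}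
    (hE : IsChannel E) (hE' : IsChannel E') {V : Matrix (R × A) A' ℂ} {V' : Matrix (R' × A) A' ℂ}
    (h : superMap E V = superMap E' V') :
    (rowMatrix V).conjTranspose * rowMatrix V = (rowMatrix V').conjTranspose * rowMatrix V' := by
  classical
  obtain ⟨b⟩ := ‹Nonempty B›
  ext ⟨a, x⟩ ⟨a', x'⟩
  rw [← trace_superMap_single hE V a a' x x' b, ← trace_superMap_single hE' V' a a' x x' b, h]

/-- A realization whose isometry has an invertible reduced operator on the auxiliary system is a
standard form. -/
theorem IsRealization.isStandardForm [Fintype A] [Fintype A'] [Fintype B] [Nonempty B]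
    [DecidableEq A'] {Θ : MatMap A B → MatMap A' B} {r : ℕ} {E : MatMap (Fin r × B) B}
    {V : Matrix (Fin r × A) A' ℂ} (h : IsRealization Θ r E V)
    (hV : IsUnit (rowMatrix V * (rowMatrix V).conjTranspose)) : IsStandardForm Θ r E V := by
  refine ⟨h, fun r' E' V' h' => ?_⟩
  have hg := rowMatrix_gram_eq_of_superMap_eq h.1 h'.1 (h.2.2.symm.trans h'.2.2)
  -- Equal Gram matrices have equal rank: r on one side, at most r' on the other.
  have h1 := congrArg Matrix.rank hg
  rw [Matrix.rank_conjTranspose_mul_self, Matrix.rank_conjTranspose_mul_self,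
    ← Matrix.rank_self_mul_conjTranspose, Matrix.rank_of_isUnit _ hV, Fintype.card_fin] at h1
  rw [h1]
  simpa using Matrix.rank_le_card_height (rowMatrix V')

theorem isMixing_superMap [Fintype R] [DecidableEq R] [Fintype A] [Fintype A'] [Fintype B]
    [Nonempty B] [DecidableEq A'] [DecidableEq B] {E : MatMap (R × B) B}
    (hE : IsConditionallyUnital E) {V : Matrix (R × A) A' ℂ} (hV : IsIsometry V)
    (hrow : IsUnit (rowMatrix V * (rowMatrix V).conjTranspose)) : IsMixing (superMap E V) := by
  let e := (Fintype.equivFin R).symm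
  let eB : Fin (Fintype.card R) × B ≃ R × B := e.prodCongr (Equiv.refl B)
  let E' : MatMap (Fin (Fintype.card R) × B) B :=
    E ∘ₗ (Matrix.reindexLinearEquiv ℂ ℂ eB eB).toLinearMap
  let V' : Matrix (Fin (Fintype.card R) × A) A' ℂ := V.submatrix (e.prodCongr (Equiv.refl A)) id
  have hE' : IsChannel E' := by
    refine hE.1.comp ⟨fun k X hX => hX.submatrix
      (fun p : Fin k × R × B => (p.1, eB.symm p.2)), fun X => ?_⟩
    exact Equiv.sum_comp eB.symm fun i => X i i
  have hV' : IsIsometry V' := by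
    unfold IsIsometry at hV ⊢
    rw [← hV]
    ext i j
    exact Equiv.sum_comp (e.prodCongr (Equiv.refl A)) fun p => star (V p i) * V p j
  have hreal : IsRealization (superMap E V) _ E' V' := by
    refine ⟨hE', hV', ?_⟩
    funext N
    refine LinearMap.ext fun X => ?_
    change E _ = E _
    congr 1
    ext p q
    change N _ _ _ = N _ _ _
    refine congrArg (fun Z => N Z p.2 q.2) ?_
    ext a a'
    change (V * X * V.conjTranspose) (p.1, a) (q.1, a') =
      (V * X * V.conjTranspose) (e (e.symm p.1), a) (e (e.symm q.1), a')
    simp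
  have hrow' : IsUnit (rowMatrix V' * (rowMatrix V').conjTranspose) := by
    have : rowMatrix V' * (rowMatrix V').conjTranspose =
      (rowMatrix V * (rowMatrix V).conjTranspose).submatrix e e := rfl
    rw [this, Matrix.isUnit_submatrix_equiv]
    exact hrow
  refine ⟨_, E', V', hreal.isStandardForm hrow', hE', fun τ hτ => ⟨hE'.withSide hτ, ?_⟩⟩
  have hτ' : IsState (τ.submatrix e.symm e.symm) :=
    ⟨hτ.1.submatrix _, (Equiv.sum_comp e.symm fun i => τ i i).trans hτ.2⟩
  exact (hE.2 _ hτ').2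

end StandardForm

/-! ### The measure-and-correct protocol -/

section Core

variable {A C O : Type*} [Fintype A] [Fintype O]

/-- The map `id_C ⊗ tr(G ·)` from `C ⊗ A ⊗ O` to `C`. -/
def weightedTrace (G : Matrix (A × O) (A × O) ℂ) : MatMap ((C × A) × O) C where
  toFun X := Matrix.of fun c c' =>
    ∑ p : A × O, ∑ q : A × O, G p q * X ((c, q.1), q.2) ((c', p.1), p.2)
  map_add' X Y := by
    ext c c'
    simp [mul_add, Finset.sum_add_distrib]
  map_smul' z X := by
    ext c c'
    simp [Finset.mul_sum, mul_left_comm]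

theorem weightedTrace_apply (G : Matrix (A × O) (A × O) ℂ)
    (X : Matrix ((C × A) × O) ((C × A) × O) ℂ) (c c' : C) : weightedTrace G X c c' =
      ∑ p : A × O, ∑ q : A × O, G p q * X ((c, q.1), q.2) ((c', p.1), p.2) := rfl

/-- Up to reordering, its Choi matrix is the maximally entangled projector on CC tensored with the
transpose of G. -/
theorem isCompletelyPositive_weightedTrace [Fintype C] [DecidableEq A] [DecidableEq O]
    [DecidableEq C] {G : Matrix (A × O) (A × O) ℂ} (hG : G.PosSemidef) :
    IsCompletelyPositive (weightedTrace (C := C) G) := by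
  refine isCompletelyPositive_of_posSemidef_choi ?_
  let v : C × C → ℂ := fun p => if p.1 = p.2 then 1 else 0
  have h := ((Matrix.posSemidef_vecMulVec_self_star v).kronecker hG.transpose).submatrix
    (fun p : ((C × A) × O) × C => ((p.1.1.1, p.2), (p.1.1.2, p.1.2)))
  refine (congrArg Matrix.PosSemidef (Matrix.ext fun p q => ?_)).mpr h
  obtain ⟨⟨⟨c, a⟩, o⟩, d⟩ := p
  obtain ⟨⟨⟨c', a'⟩, o'⟩, d'⟩ := q
  simp only [choi, Matrix.of_apply, weightedTrace_apply, Matrix.submatrix_apply,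
    Matrix.kroneckerMap_apply, Matrix.vecMulVec_apply, Matrix.transpose_apply, Pi.star_apply, v]
  rw [Finset.sum_eq_single (a', o') _ (by simp), Finset.sum_eq_single (a, o) _ (by simp)]
  · by_cases h1 : c = d <;> by_cases h2 : c' = d' <;> simp [h1, h2]
  · rintro ⟨a1, o1⟩ - hne
    rw [Matrix.single_apply, if_neg, mul_zero]
    rintro ⟨h1, -⟩
    simp only [Prod.mk.injEq] at h1
    exact hne (Prod.ext h1.1.2.symm h1.2.symm)
  · rintro ⟨a1, o1⟩ - hne
    refine Finset.sum_eq_zero fun q _ => ?_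
    rw [Matrix.single_apply, if_neg, mul_zero]
    rintro ⟨-, h1⟩
    simp only [Prod.mk.injEq] at h1
    exact hne (Prod.ext h1.1.2.symm h1.2.symm)

theorem weightedTrace_add (G H : Matrix (A × O) (A × O) ℂ)
    (X : Matrix ((C × A) × O) ((C × A) × O) ℂ) :
    weightedTrace (G + H) X = weightedTrace G X + weightedTrace H X := by
  ext c c'
  simp [weightedTrace_apply, add_mul, Finset.sum_add_distrib]

theorem trace_weightedTrace_one [Fintype C] [DecidableEq A] [DecidableEq O]
    (X : Matrix ((C × A) × O) ((C × A) × O) ℂ) : (weightedTrace 1 X).trace = X.trace := by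
  simp [Matrix.trace, weightedTrace_apply, Matrix.one_apply, Fintype.sum_prod_type]

/-- The partial trace over the second factor. -/
def partialTraceRight (τ : Matrix (C × A) (C × A) ℂ) : Matrix C C ℂ :=
  Matrix.of fun c c' => ∑ a, τ (c, a) (c', a)

theorem trace_partialTraceRight [Fintype C] (τ : Matrix (C × A) (C × A) ℂ) :
    (partialTraceRight τ).trace = τ.trace := by
  simp [Matrix.trace, partialTraceRight, Fintype.sum_prod_type]

theorem weightedTrace_kronecker_one [DecidableEq A] [DecidableEq O]
    {G : Matrix (A × O) (A × O) ℂ} {g : ℂ}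
    (hG : ∀ a a', ∑ o, G (a, o) (a', o) = if a = a' then g else 0)
    (τ : Matrix (C × A) (C × A) ℂ) :
    weightedTrace G (τ ⊗ₖ (1 : Matrix O O ℂ)) = g • partialTraceRight τ := by
  ext c c'
  have h : ∀ a a', ∑ o, G (a, o) (a', o) * τ (c, a') (c', a) =
      if a = a' then g * τ (c, a) (c', a) else 0 := by
    intro a a'
    rw [← Finset.sum_mul, hG]
    by_cases h : a = a' <;> simp [h]
  simp only [weightedTrace_apply, Matrix.kroneckerMap_apply, Matrix.one_apply,
    Fintype.sum_prod_type, mul_ite, mul_one, mul_zero, Finset.sum_ite_eq', Finset.mem_univ, if_true,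
    Matrix.smul_apply, partialTraceRight, Matrix.of_apply, smul_eq_mul, Finset.mul_sum]
  refine Finset.sum_congr rfl fun a _ => ?_
  rw [Finset.sum_comm]
  simp [h]

/-- The isometry `|c⟩ ↦ |c⟩ ⊗ |Φ⟩` that appends a maximally entangled state `Φ` of `A ⊗ A`. -/
noncomputable def appendEntangled (C A : Type*) [Fintype A] [DecidableEq A] [DecidableEq C] :
    Matrix ((C × A) × A) C ℂ :=
  Matrix.of fun p c => if p.1.1 = c ∧ p.1.2 = p.2 then ((√(Fintype.card A : ℝ))⁻¹ : ℂ) else 0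

theorem inv_sqrt_card_mul_self (A : Type*) [Fintype A] :
    ((√(Fintype.card A : ℝ))⁻¹ : ℂ) * ((√(Fintype.card A : ℝ))⁻¹ : ℂ) =
      (Fintype.card A : ℂ)⁻¹ := by
  rw [← mul_inv, ← Complex.ofReal_mul, Real.mul_self_sqrt (by positivity), Complex.ofReal_natCast]

variable [DecidableEq A] [DecidableEq C]

theorem isIsometry_appendEntangled [Fintype C] [Nonempty A] :
    IsIsometry (appendEntangled C A) := by
  unfold IsIsometry
  ext c c'
  have hA : (Fintype.card A : ℂ) ≠ 0 := by simp
  simp only [Matrix.mul_apply, Matrix.conjTranspose_apply, appendEntangled, Matrix.of_apply,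
    Fintype.sum_prod_type, apply_ite star, star_zero, ite_and, star_inv₀,
    Complex.star_def, Complex.conj_ofReal]
  by_cases h : c = c'
  · subst h
    simp [inv_sqrt_card_mul_self, hA]
  · simp [h, Ne.symm h]

/-- Half of a maximally entangled state is uniform, hence of full rank; this supplies the minimality
of CA. -/
theorem isUnit_rowMatrix_appendEntangled [Fintype C] [Nonempty A] :
    IsUnit (rowMatrix (appendEntangled C A) *
      (rowMatrix (appendEntangled C A)).conjTranspose) := by
  have h : rowMatrix (appendEntangled C A) * (rowMatrix (appendEntangled C A)).conjTranspose =
      (Fintype.card A : ℂ)⁻¹ • 1 := by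
    ext ⟨c, a⟩ ⟨c', a'⟩
    simp only [Matrix.mul_apply, Matrix.conjTranspose_apply, appendEntangled, Matrix.of_apply,
      rowMatrix, Fintype.sum_prod_type, apply_ite star, star_zero, ite_and, star_inv₀,
      Complex.star_def, Complex.conj_ofReal, Matrix.smul_apply, Matrix.one_apply, Prod.mk.injEq]
    by_cases h : c = c'
    · subst h
      by_cases h' : a = a'
      · subst h'
        simp [inv_sqrt_card_mul_self]
      · simp [h']
    · simp [h]
  rw [h]
  rw [Matrix.isUnit_iff_isUnit_det, Matrix.det_smul, Matrix.det_one, mul_one]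
  exact (isUnit_iff_ne_zero.2 (by simp)).pow _

/-- The scalar is the probability of the effect G on the normalized Choi state of N; C stays
uncorrelated with it. -/
theorem weightedTrace_ampliate_appendEntangled [Fintype C] (G : Matrix (A × O) (A × O) ℂ)
    (N : MatMap A O) (X : Matrix C C ℂ) :
    weightedTrace G (ampliate (C × A) N (conjMap (appendEntangled C A) X)) =
      ((Fintype.card A : ℂ)⁻¹ * (G * choi N).trace) • X := by
  have hblock : ∀ c c' a a', (Matrix.of fun i j =>
      (conjMap (appendEntangled C A) X) ((c, a), i) ((c', a'), j)) =
      ((Fintype.card A : ℂ)⁻¹ * X c c') • Matrix.single a a' (1 : ℂ) := by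
    intro c c' a a'
    ext i j
    change (appendEntangled C A * X * (appendEntangled C A).conjTranspose) _ _ = _
    simp only [Matrix.mul_apply, Matrix.conjTranspose_apply, appendEntangled, Matrix.of_apply,
      apply_ite star, star_zero, ite_and, star_inv₀, Complex.star_def, Complex.conj_ofReal,
      Matrix.smul_apply, Matrix.single_apply, ite_mul, zero_mul, mul_ite, mul_zero,
      Finset.sum_ite_eq, Finset.mem_univ, if_true]
    rw [← inv_sqrt_card_mul_self]
    by_cases h1 : a = i <;> by_cases h2 : a' = j <;> simp [h1, h2, mul_right_comm]
  ext c c'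
  rw [weightedTrace_apply, Matrix.smul_apply, Matrix.trace, smul_eq_mul, Finset.mul_sum,
    Finset.sum_mul]
  refine Finset.sum_congr rfl fun p _ => ?_
  rw [Matrix.diag_apply, Matrix.mul_apply, Finset.mul_sum, Finset.sum_mul]
  refine Finset.sum_congr rfl fun q _ => ?_
  change G p q * N _ q.2 p.2 = _ * (G p q * N _ q.2 p.2) * _
  rw [hblock, map_smul, Matrix.smul_apply, smul_eq_mul]
  ring

variable [DecidableEq O] [Fintype C]

/-- Let `N` be a channel whose Choi matrix is `s` times a projection. Then `N` majorizes every
channel `T` such that `Z ↦ (tr Z) 1 - s⁻¹ T(Z)` is completely positive. -/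
theorem majorizes_of_choi_mul_self [Nonempty A] [Nonempty C] [Nonempty O] {N : MatMap A O}
    {T : MatMap C O} (hN : IsChannel N) (hT : IsChannel T) {s : ℝ} (hs : 0 < s)
    (hJ : choi N * choi N = (s : ℂ) • choi N)
    (hS : IsCompletelyPositive (traceSubSMul ((s⁻¹ : ℝ) : ℂ) T)) : Majorizes N T := by
  have hs' : (s : ℂ) ≠ 0 := by exact_mod_cast hs.ne'
  have hA : (Fintype.card A : ℂ) ≠ 0 := by simp
  have hs0 : (0 : ℂ) ≤ ((s⁻¹ : ℝ) : ℂ) := by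
    have := inv_nonneg.2 hs.le
    exact_mod_cast this
  obtain ⟨t, ht⟩ : ∃ t : ℂ, t = ((s⁻¹ : ℝ) : ℂ) := ⟨_, rfl⟩
  have hts : t * s = 1 := by rw [ht, Complex.ofReal_inv, inv_mul_cancel₀ hs']
  rw [← ht] at hS hs0
  obtain ⟨P, hP⟩ : ∃ P, P = t • choi N := ⟨_, rfl⟩
  have hPpsd : P.PosSemidef := hP ▸ hN.1.posSemidef_choi.smul hs0
  have hPP : P * P = P := by
    rw [hP, Matrix.smul_mul, Matrix.mul_smul, hJ, smul_smul t (s : ℂ), hts, one_smul]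
  have hQpsd : (1 - P).PosSemidef := by
    have h : (1 - P).conjTranspose * (1 - P) = 1 - P := by
      rw [Matrix.conjTranspose_sub, Matrix.conjTranspose_one, hPpsd.1]
      simp [mul_sub, sub_mul, hPP]
    rw [← h]
    exact Matrix.posSemidef_conjTranspose_mul_self _
  have hPtr : P.trace = t * Fintype.card A := by
    rw [hP, Matrix.trace_smul, trace_choi, hN.2, Matrix.trace_one, smul_eq_mul]
  -- This one constant is both the factor in tr_O(1 - P) = κ 1 and the trace factor of S, so
  -- dividing by it restores both trace preservation and unitality.
  obtain ⟨κ, hκ⟩ : ∃ κ : ℂ, κ = Fintype.card O - t := ⟨_, rfl⟩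
  have hQtr : (1 - P).trace = Fintype.card A * κ := by
    rw [Matrix.trace_sub, hPtr, Matrix.trace_one, Fintype.card_prod, hκ]
    push_cast
    ring
  have hκ0 : 0 ≤ κ := by
    have h := hQpsd.trace_nonneg
    rw [hQtr] at h
    have h2 := mul_nonneg (show (0 : ℂ) ≤ (Fintype.card A : ℂ)⁻¹ by positivity) h
    rwa [inv_mul_cancel_left₀ hA] at h2
  have hStr : ∀ Z, (traceSubSMul t T Z).trace = κ * Z.trace := by
    intro Z
    rw [traceSubSMul_apply, Matrix.trace_sub, Matrix.trace_smul, Matrix.trace_smul, hT.2,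
      Matrix.trace_one, hκ]
    simp only [smul_eq_mul]
    ring
  have hPpart : ∀ a a', ∑ o, P (a, o) (a', o) = if a = a' then t else 0 := by
    intro a a'
    have : ∑ o, P (a, o) (a', o) = t * (N (Matrix.single a a' 1)).trace := by
      rw [hP, Matrix.trace, Finset.mul_sum]
      rfl
    rw [this, hN.2]
    by_cases h : a = a' <;> simp [h]
  have hQpart : ∀ a a', ∑ o, (1 - P) (a, o) (a', o) = if a = a' then κ else 0 := by
    intro a a'
    simp only [Matrix.sub_apply, Finset.sum_sub_distrib, hPpart, hκ]
    by_cases h : a = a' <;> simp [h, Matrix.one_apply]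
  let E : MatMap ((C × A) × O) O :=
    T ∘ₗ weightedTrace P + κ⁻¹ • (traceSubSMul t T ∘ₗ weightedTrace (1 - P))
  have hEapply : ∀ X, E X =
      T (weightedTrace P X) + κ⁻¹ • traceSubSMul t T (weightedTrace (1 - P) X) := fun _ => rfl
  have hE : IsChannel E := by
    refine ⟨(hT.1.comp (isCompletelyPositive_weightedTrace hPpsd)).add
      ((hS.comp (isCompletelyPositive_weightedTrace hQpsd)).smul (inv_nonneg.2 hκ0)),
      fun X => ?_⟩
    have h1 : (weightedTrace P X).trace + (weightedTrace (1 - P) X).trace = X.trace := by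
      rw [← Matrix.trace_add, ← weightedTrace_add, add_sub_cancel, trace_weightedTrace_one]
    rw [hEapply, Matrix.trace_add, Matrix.trace_smul, hStr, hT.2, ← h1, smul_eq_mul]
    -- For κ = 0 the convention 0⁻¹ = 0 drops the second branch; nothing is lost, as 1 - P is
    -- positive with trace zero.
    by_cases hk : κ = 0
    · have hQ : 1 - P = 0 := hQpsd.trace_eq_zero_iff.1 (by rw [hQtr, hk, mul_zero])
      have : weightedTrace (1 - P) X = 0 := by
        ext c c'
        simp [weightedTrace_apply, hQ]
      simp [this]
    · rw [inv_mul_cancel_left₀ hk]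
  have hEu : IsConditionallyUnital E := by
    refine ⟨hE, fun τ hτ => ⟨hE.withSide hτ, ?_⟩⟩
    change E (τ ⊗ₖ 1) = 1
    have hz : κ⁻¹ • (κ • traceSubSMul t T (partialTraceRight τ)) =
        traceSubSMul t T (partialTraceRight τ) := by
      -- Here κ = 0 forces S = 0, since its Choi matrix is positive with trace zero.
      by_cases hk : κ = 0
      · have h0 : traceSubSMul t T = 0 := by
          refine eq_zero_of_choi_eq_zero (hS.posSemidef_choi.trace_eq_zero_iff.1 ?_)
          rw [trace_choi, hStr, hk, zero_mul]
        simp [h0]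
      · rw [smul_smul, inv_mul_cancel₀ hk, one_smul]
    rw [hEapply, weightedTrace_kronecker_one hPpart, weightedTrace_kronecker_one hQpart, map_smul,
      map_smul, hz, traceSubSMul_apply, trace_partialTraceRight, hτ.2, one_smul, add_sub_cancel]
  refine ⟨superMap E (appendEntangled C A), isMixing_superMap hEu isIsometry_appendEntangled
    isUnit_rowMatrix_appendEntangled, ?_⟩
  refine LinearMap.ext fun X => ?_
  change T X = E (ampliate (C × A) N (conjMap (appendEntangled C A) X))
  have hPJ : (P * choi N).trace = Fintype.card A := by
    have h : P * choi N = choi N := by rw [hP, Matrix.smul_mul, hJ, smul_smul, hts, one_smul]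
    rw [h, trace_choi, hN.2, Matrix.trace_one]
  have hQJ : ((1 - P) * choi N).trace = 0 := by
    rw [Matrix.sub_mul, Matrix.trace_sub, hPJ, Matrix.one_mul, trace_choi, hN.2, Matrix.trace_one,
      sub_self]
  rw [hEapply, weightedTrace_ampliate_appendEntangled, weightedTrace_ampliate_appendEntangled, hPJ,
    hQJ, inv_mul_cancel₀ hA]
  simp

end Core

/-! ### Choi matrices proportional to projections -/

/-- If a map is a multiple of a sum of conjugations by pairwise orthogonal matrices of equal
Hilbert-Schmidt norm, then its Choi matrix is proportional to a projection. -/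
theorem choi_mul_self_of_kraus {A O S : Type*} [Fintype A] [DecidableEq A] [Fintype O] [Fintype S]
    [DecidableEq S] {N : MatMap A O} {t g : ℂ} (K : S → Matrix O A ℂ)
    (hN : N = t • ∑ i, conjMap (K i))
    (hK : ∀ i j, ((K i).conjTranspose * K j).trace = if i = j then g else 0) :
    choi N * choi N = (t * g) • choi N := by
  let v : S → A × O → ℂ := fun i p => K i p.2 p.1
  have hJ : choi N = t • ∑ i, Matrix.vecMulVec (v i) (star (v i)) := by
    simp only [v, ← choi_conjMap]
    ext p q
    simp only [choi, hN, Matrix.of_apply, Matrix.smul_apply, Matrix.sum_apply,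
      LinearMap.smul_apply, LinearMap.sum_apply]
  have hdot : ∀ i j, star (v i) ⬝ᵥ v j = if i = j then g else 0 := by
    intro i j
    rw [← hK, Matrix.trace, dotProduct, Fintype.sum_prod_type]
    rfl
  have hsum : (∑ i, Matrix.vecMulVec (v i) (star (v i))) *
      ∑ i, Matrix.vecMulVec (v i) (star (v i)) =
        g • ∑ i, Matrix.vecMulVec (v i) (star (v i)) := by
    rw [Finset.sum_mul, Finset.smul_sum]
    refine Finset.sum_congr rfl fun i _ => ?_
    rw [Finset.mul_sum]
    simp only [Matrix.vecMulVec_mul_vecMulVec, hdot]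
    rw [Finset.sum_eq_single i]
    · ext p q
      simp [Matrix.vecMulVec_apply, mul_left_comm]
    · intro j _ hj
      ext p q
      simp [Matrix.vecMulVec_apply, Ne.symm hj]
    · simp
  rw [hJ, Matrix.smul_mul, Matrix.mul_smul, hsum]
  simp only [smul_smul]
  congr 1
  ring

theorem choi_mul_self_conjMap {A B : Type*} [Fintype A] [DecidableEq A] [Fintype B]
    {V : Matrix B A ℂ} (hV : IsIsometry V) :
    choi (conjMap V) * choi (conjMap V) = (Fintype.card A : ℂ) • choi (conjMap V) := by
  have h := choi_mul_self_of_kraus (N := conjMap V) (S := Unit) (t := 1) (g := Fintype.card A)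
    (fun _ => V) (by simp) (by
      intro i j
      rw [hV, Matrix.trace_one]
      simp)
  rwa [one_mul] at h

theorem choi_mul_self_stateChannel {B : Type*} [Fintype B] {ψ : Matrix B B ℂ}
    (h : IsPureState ψ) :
    choi (stateChannel ψ) * choi (stateChannel ψ) = choi (stateChannel ψ) := by
  obtain ⟨v, hv, rfl⟩ := h
  rw [choi_stateChannel]
  ext p q
  rw [Matrix.mul_apply, Fintype.sum_prod_type]
  simp only [Matrix.submatrix_apply, Finset.univ_unique, Finset.sum_singleton]
  rw [← Matrix.mul_apply, Matrix.vecMulVec_mul_vecMulVec, hv, one_smul]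

/-- The Choi matrix of the channel `X ↦ W (V X V† ⊗ u) W†` is proportional to a projection. -/
theorem choi_mul_self_conjMap_comp_tensorUniform {A B S O : Type*} [Fintype A] [DecidableEq A]
    [Fintype B] [DecidableEq B] [Fintype S] [DecidableEq S] [Fintype O] {V : Matrix B A ℂ}
    (hV : IsIsometry V) {W : Matrix O (B × S) ℂ} (hW : IsIsometry W) :
    choi (conjMap W ∘ₗ tensorUniform S (conjMap V)) *
        choi (conjMap W ∘ₗ tensorUniform S (conjMap V)) =
      ((Fintype.card S : ℂ)⁻¹ * Fintype.card A) •
        choi (conjMap W ∘ₗ tensorUniform S (conjMap V)) := by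
  -- Kraus operators V ⊗ |i⟩, from expanding the uniform state in the basis of S; distinct i give
  -- orthogonal ranges.
  let L : S → Matrix (B × S) A ℂ := fun i => Matrix.of fun p a => if p.2 = i then V p.1 a else 0
  have hL : ∀ X, tensorUniform S (conjMap V) X =
      (Fintype.card S : ℂ)⁻¹ • ∑ i, L i * X * (L i).conjTranspose := by
    intro X
    change (V * X * V.conjTranspose) ⊗ₖ uniformState S = _
    rw [uniformState, Matrix.kronecker_smul]
    congr 1
    ext p q
    have hc : ∀ i, (L i * X * (L i).conjTranspose) p q =
        if p.2 = i then (if q.2 = i then (V * X * V.conjTranspose) p.1 q.1 else 0) else 0 := by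
      intro i
      simp only [L, Matrix.mul_apply, Matrix.conjTranspose_apply, Matrix.of_apply]
      by_cases h1 : p.2 = i <;> by_cases h2 : q.2 = i <;> simp [h1, h2]
    simp [Matrix.sum_apply, hc, Matrix.one_apply, eq_comm]
  refine choi_mul_self_of_kraus (fun i => W * L i) (LinearMap.ext fun X => ?_) fun i j => ?_
  · change W * tensorUniform S (conjMap V) X * W.conjTranspose = _
    rw [hL]
    simp only [LinearMap.smul_apply, LinearMap.sum_apply, conjMap, LinearMap.coe_mk,
      AddHom.coe_mk, Matrix.conjTranspose_mul, Matrix.mul_smul, Matrix.smul_mul,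
      Matrix.mul_assoc, Matrix.mul_sum, Matrix.sum_mul]
  · have h1 : (W * L i).conjTranspose * (W * L j) = (L i).conjTranspose * L j := by
      rw [Matrix.conjTranspose_mul, Matrix.mul_assoc, ← Matrix.mul_assoc W.conjTranspose, hW,
        Matrix.one_mul]
    have h2 : (L i).conjTranspose * L j = if i = j then V.conjTranspose * V else 0 := by
      ext a a'
      by_cases h : i = j
      · subst h
        simp [L, Matrix.mul_apply, Fintype.sum_prod_type]
      · simp [L, Matrix.mul_apply, Fintype.sum_prod_type, h, Ne.symm h]
    rw [h1, h2, hV]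
    by_cases h : i = j <;> simp [h]

end ChannelMajorization

/-! ### The three claims: values of s and dimension counts -/

theorem theorem13 {A B B' C D D' : Type*}
    [Fintype A] [DecidableEq A] [Nonempty A] [Fintype B] [DecidableEq B] [Nonempty B]
    [Fintype B'] [DecidableEq B'] [Nonempty B'] [Fintype C] [DecidableEq C] [Nonempty C]
    [Fintype D] [DecidableEq D] [Nonempty D] [Fintype D'] [DecidableEq D'] [Nonempty D']
    (𝒱 : MatMap A B) (h𝒱 : IsIsometryChannel 𝒱) :
    -- the isometry channel together with a uniform replica of `A` is equivalent to a pure state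
    (Fintype.card B' = Fintype.card A →
      ∀ ψ : Matrix (B × B') (B × B') ℂ, IsPureState ψ →
        Equivalent (tensorUniform B' 𝒱) (stateChannel ψ)) ∧
    -- majorization for all identifications `𝒲` of the output space `BB'` with `DD'`
    (Fintype.card (B × B') = Fintype.card (D × D') →
      Fintype.card (C × D) ≤ Fintype.card (A × B) →
      ∀ ℳ : MatMap C D, IsChannel ℳ →
        ∀ 𝒲 : MatMap (B × B') (D × D'), IsIsometryChannel 𝒲 →
          Majorizes (𝒲 ∘ₗ tensorUniform B' 𝒱) (tensorUniform D' ℳ)) ∧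
    -- isometry channels are maximal
    (∀ ℳ : MatMap A B, IsChannel ℳ → Majorizes 𝒱 ℳ) := by
  have hch := h𝒱.isChannel
  obtain ⟨V, hV, rfl⟩ := h𝒱
  have hA : (0 : ℝ) < Fintype.card A := by exact_mod_cast Fintype.card_pos
  have hB : (0 : ℝ) < Fintype.card B := by exact_mod_cast Fintype.card_pos
  have hB' : (0 : ℝ) < Fintype.card B' := by exact_mod_cast Fintype.card_pos
  have hD : (0 : ℝ) < Fintype.card D := by exact_mod_cast Fintype.card_pos
  refine ⟨fun hcard ψ hψ => ⟨?_, ?_⟩, fun h1 h2 ℳ hℳ 𝒲 h𝒲 => ?_, fun ℳ hℳ => ?_⟩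
  · have hψ' := hψ.isState.isChannel_stateChannel
    refine majorizes_of_choi_mul_self (hch.tensorUniform B') hψ' one_pos ?_
      (hψ'.isCompletelyPositive_traceSubSMul (by norm_num) (by norm_num))
    have hone : IsIsometry (1 : Matrix (B × B') (B × B') ℂ) := by simp [IsIsometry]
    have hid : conjMap (1 : Matrix (B × B') (B × B') ℂ) ∘ₗ tensorUniform B' (conjMap V) =
        tensorUniform B' (conjMap V) := LinearMap.ext fun X => by simp [conjMap]
    have h := choi_mul_self_conjMap_comp_tensorUniform hV hone
    rw [hid, hcard, inv_mul_cancel₀ (by simp)] at h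
    simpa using h
  · refine majorizes_of_choi_mul_self hψ.isState.isChannel_stateChannel (hch.tensorUniform B')
      one_pos ?_ (hch.isCompletelyPositive_traceSubSMul_tensorUniform B' (by norm_num)
        (by simp [hcard]))
    simpa using choi_mul_self_stateChannel hψ
  · have hWch := h𝒲.isChannel
    obtain ⟨W, hW, rfl⟩ := h𝒲
    refine majorizes_of_choi_mul_self (s := (Fintype.card B' : ℝ)⁻¹ * Fintype.card A)
      (hWch.comp (hch.tensorUniform B')) (hℳ.tensorUniform D') (by positivity) ?_
      (hℳ.isCompletelyPositive_traceSubSMul_tensorUniform D' (by positivity) ?_)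
    · simpa using choi_mul_self_conjMap_comp_tensorUniform hV hW
    · simp only [Fintype.card_prod] at h1 h2
      have h1' : (Fintype.card B * Fintype.card B' : ℝ) = Fintype.card D * Fintype.card D' := by
        exact_mod_cast h1
      have h2' : (Fintype.card C * Fintype.card D : ℝ) ≤ Fintype.card A * Fintype.card B := by
        exact_mod_cast h2
      rw [mul_inv, inv_inv, ← div_eq_mul_inv, div_mul_eq_mul_div, div_le_iff₀ hA]
      -- The goal |B'||C| ≤ |D'||A| becomes, after multiplication by |B||D|, the product of the two
      -- dimension hypotheses.
      refine le_of_mul_le_mul_right ?_ (mul_pos hB hD)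
      calc (Fintype.card B' : ℝ) * Fintype.card C * (Fintype.card B * Fintype.card D)
          = (Fintype.card B * Fintype.card B') * (Fintype.card C * Fintype.card D) := by ring
        _ ≤ (Fintype.card B * Fintype.card B') * (Fintype.card A * Fintype.card B) := by gcongr
        _ = Fintype.card D' * Fintype.card A * (Fintype.card B * Fintype.card D) := by
          rw [h1']; ring
  -- Here s = |A| and ℳ also has input A, so the domination bound holds with equality.
  · exact majorizes_of_choi_mul_self (s := Fintype.card A) hch hℳ hA
      (by simpa using choi_mul_self_conjMap hV)
      (hℳ.isCompletelyPositive_traceSubSMul (by positivity) (inv_mul_cancel₀ hA.ne').le)
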